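/- Let $n, p \ge 1$ and $b > 1$ be integers with $b \equiv 1 \pmod p$. Let $G_{p,n}$ be the group, under composition, of the bijections $\sigma$ of $\Sigma = \{1,\dots,n\} \times \mathbb{Z}_p$ that commute with the shift $(i,r) \mapsto (i,r+1)$, and write $\sigma(i,0) = (\sigma(i), \sigma_c(i))$. Order $\Sigma$ linearly by color class in the order $0, p-1, p-2, \dots, 1$ of the colors, and by the first entry inside each color class. Let $d(\sigma)$ be the number of descents of $\sigma$, where $i<n$ is a descent if $\sigma(i,0) > \sigma(i+1,0)$, and $n$ is a descent if $\sigma_c(n) \ne 0$. Let $\ell = n$ if $p \ne 1$ and $\ell = n-1$ if $p = 1$. The $(b,n,p)$-shuffle is the following random element of $G_{p,n}$: take independent uniform labels $A_1,\dots,A_n \in \{0,\dots,b-1\}$, let $\sigma(i)$ be the rank of $A_i$ among the labels (equal labels being ranked by increasing index), and let $\sigma_c(i) = A_i \bmod p$. Let $\sigma(k+1) = S_{k+1} \circ \sigma(k)$, $\sigma(0) = \mathrm{id}$, be the random walk on $G_{p,n}$ driven by independent $(b,n,p)$-shuffles $S_1, S_2, \dots$, and let $P_s(\mu,\tau) = \mathbf{P}(S_1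 \circ \mu = \tau)$ be its transition matrix. In $\mathbb{C}[G_{p,n}]$ put $D_i = \sum_{d(\sigma)=i} \sigma$ and $\Theta_i = \sum_{d(\sigma^{-1})=i} \sigma$, and for $0 \le i,j \le \ell$ let $$u_{ij} = [x^{n-j}] \binom{n + \frac{x-1}{p} - i}{n}, \qquad e_{\ell-j} = \sum_{i=0}^{\ell} u_{ij} \Theta_i, \qquad f_{\ell-j} = \sum_{i=0}^{\ell} u_{ij} D_i ,$$ where $\binom{y}{n} = \frac{1}{n!}\, y(y-1)\cdots(y-n+1)$ and $[x^m]$ denotes the coefficient of $x^m$. Then $$\sum_{\sigma} \mathbf{P}(\text{shuffle} = \sigma)\, \sigma = \sum_{k=0}^{\ell} b^{-k} e_{\ell-k}, \qquad \sum_{\sigma} \mathbf{P}(\text{shuffle}^{-1} = \sigma)\, \sigma = \sum_{k=0}^{\ell} b^{-k} f_{\ell-k},$$ and, identifying vectors indexed by $G_{p,n}$ with elements of $\mathbb{C}[G_{p,n}]$ and writing $L(a) : x \mapsto ax$ for the left regular representation: (1) The set of eigenvalues of $P_s$ is $\{b^{-j} : 0 \le j \le \ell\}$. For $0 \le j \le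 \ell$, the left eigenspace $\{x : xP_s = b^{-j}x\}$ is $\operatorname{Range} L(e_{\ell-j})$, and the right eigenspace $\{y : P_s y = b^{-j} y\}$ is $\operatorname{Range} L(f_{\ell-j})$. (2) For $0 \le j \le \ell$, the multiplicity of the eigenvalue $b^{-j}$ (the dimension of the left eigenspace, that of the right eigenspace, and the algebraic multiplicity) is $u_{0j}\, p^n\, n!$, and this is the Stirling–Frobenius cycle number $c_p(n, n-j)$, where $c_p(0,0) = 1$, $c_p(0,k) = 0$ for $k \ne 0$, and $c_p(m,k) = c_p(m-1,k-1) + (pm-1)\, c_p(m-1,k)$ for $m \ge 1$ and $k \ge 0$, with $c_p(m-1,-1) = 0$. -/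

import Mathlib

/-- The color shift `T_q (i, r) = (i, r + q)` on `Σ = [n] × ℤ_p`; the element `i` of `[n]` is
represented by `i - 1 : Fin n`. -/
def colorShift (n p : ℕ) (q : ZMod p) : Equiv.Perm (Fin n × ZMod p) where
  toFun x := (x.1, x.2 + q)
  invFun x := (x.1, x.2 - q)
  left_inv x := by simp
  right_inv x := by simp

/-- The bijections of `Σ` that commute with `T_1`, as a subgroup of the permutations of `Σ`;
the product is the composition of maps, `(σ * τ) x = σ (τ x)`. -/
def coloredPermGroup (n p : ℕ) : Subgroup (Equiv.Perm (Fin n × ZMod p)) :=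
  Subgroup.centralizer {colorShift n p 1}

/-- The colored permutation group `G_{p,n}`. -/
abbrev ColoredPerm (n p : ℕ) : Type := ↥(coloredPermGroup n p)

noncomputable instance (n p : ℕ) [NeZero p] : Fintype (ColoredPerm n p) :=
  Fintype.ofFinite _

namespace ColoredPerm

/-- The usual linear order on `Σ`: the color classes come in the order `0, p-1, p-2, …, 1`, and
inside a color class the elements are ordered by their first entry. -/
def lt {n p : ℕ} (x y : Fin n × ZMod p) : Prop :=
  (-x.2).val < (-y.2).val ∨ (x.2 = y.2 ∧ x.1 < y.1)

/-- `σ` has a d-descent at `i` (at the last position: `σ_c(n) ≠ 0`). -/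
def HasDescent {n p : ℕ} (σ : ColoredPerm n p) (i : Fin n) : Prop :=
  if h : (i : ℕ) + 1 < n then lt (σ.1 (⟨(i : ℕ) + 1, h⟩, 0)) (σ.1 (i, 0))
  else (σ.1 (i, 0)).2 ≠ 0

open Classical in
/-- The number `d(σ)` of d-descents. -/
noncomputable def descents {n p : ℕ} (σ : ColoredPerm n p) : ℕ :=
  (Finset.univ.filter (fun i : Fin n => σ.HasDescent i)).card

/-- The colored permutation `π[A]` with labels `A_1, …, A_n ∈ {0, …, b-1}`.
`Tuple.sort A` is the permutation `j ↦ i(j)` that lists the positions by increasing label, equal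
labels in increasing order of position; so `σ⁻¹(j) = i(j)`, and the color of `σ(i)` is
`A_i mod p`. -/
def ofLabels {n b : ℕ} (p : ℕ) (A : Fin n → Fin b) : ColoredPerm n p :=
  ⟨{ toFun := fun x => ((Tuple.sort A).symm x.1, x.2 + ((A x.1 : ℕ) : ZMod p))
     invFun := fun y => (Tuple.sort A y.1, y.2 - ((A (Tuple.sort A y.1) : ℕ) : ZMod p))
     left_inv := fun x => by simp
     right_inv := fun y => by simp },
   by
    rw [coloredPermGroup, Subgroup.mem_centralizer_singleton_iff]
    ext x
    · simp [colorShift]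
    · simp [colorShift, add_right_comm]⟩

end ColoredPerm

namespace Shuffle

open ColoredPerm

/-- The largest number of descents: `ℓ = n` for `p ≠ 1` and `ℓ = n - 1` for `p = 1`. -/
def ell (n p : ℕ) : ℕ := if p = 1 then n - 1 else n

/-- The law of the `(b, n, p)`-shuffle: `π[A]` with uniformly distributed labels. -/
noncomputable def law (b n p : ℕ) [NeZero b] : PMF (ColoredPerm n p) :=
  (PMF.uniformOfFintype (Fin n → Fin b)).map (ofLabels p)

/-- One step of the random walk `σ(k+1) = S ∘ σ(k)`: the law of `S ∘ μ`, where `S` is a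
`(b, n, p)`-shuffle. -/
noncomputable def step (b n p : ℕ) [NeZero b] (μ : ColoredPerm n p) : PMF (ColoredPerm n p) :=
  (law b n p).map (fun s => s * μ)

/-- The transition matrix `P_s(μ, τ) = P(σ(k+1) = τ | σ(k) = μ)` of the random walk. -/
noncomputable def transition (b n p : ℕ) [NeZero b] :
    Matrix (ColoredPerm n p) (ColoredPerm n p) ℂ :=
  Matrix.of fun μ τ => ((step b n p μ τ).toReal : ℂ)

/-- The polynomial `binom(n + (x - 1)/p - i, n)` in `x`. -/
noncomputable def binomPoly (n p i : ℕ) : Polynomial ℚ :=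
  Polynomial.C (1 / (n.factorial : ℚ)) *
    ∏ m ∈ Finset.range n,
      (Polynomial.C (n : ℚ) + Polynomial.C (1 / (p : ℚ)) * (Polynomial.X - 1)
        - Polynomial.C (i : ℚ) - Polynomial.C (m : ℚ))

/-- `u_{ij} = [x^{n-j}] binom(n + (x - 1)/p - i, n)`, for `0 ≤ i, j ≤ ℓ`. -/
noncomputable def u (n p i j : ℕ) : ℚ := (binomPoly n p i).coeff (n - j)

variable {n p : ℕ} [NeZero p]

open Classical in
/-- `D_i`, the sum of the `σ` with `d(σ) = i`. -/
noncomputable def D (n p : ℕ) [NeZero p] (i : ℕ) : MonoidAlgebra ℂ (ColoredPerm n p) :=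
  ∑ σ ∈ Finset.univ.filter (fun σ : ColoredPerm n p => σ.descents = i), MonoidAlgebra.single σ 1

open Classical in
/-- `Θ_i`, the sum of the `σ` with `d(σ⁻¹) = i`. -/
noncomputable def Theta (n p : ℕ) [NeZero p] (i : ℕ) : MonoidAlgebra ℂ (ColoredPerm n p) :=
  ∑ σ ∈ Finset.univ.filter (fun σ : ColoredPerm n p => σ⁻¹.descents = i),
    MonoidAlgebra.single σ 1

/-- `e_m` for `0 ≤ m ≤ ℓ`: with `m = ℓ - k`, this is the coefficient of `x^{n-k}` in the
polynomial `∑ i, binom(n + (x - 1)/p - i, n) Θ_i`. -/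
noncomputable def e (n p : ℕ) [NeZero p] (m : ℕ) : MonoidAlgebra ℂ (ColoredPerm n p) :=
  ∑ i ∈ Finset.range (ell n p + 1), (u n p i (ell n p - m) : ℂ) • Theta n p i

/-- `f_m` for `0 ≤ m ≤ ℓ`: with `m = ℓ - k`, this is the coefficient of `x^{n-k}` in the
polynomial `∑ i, binom(n + (x - 1)/p - i, n) D_i`. -/
noncomputable def f (n p : ℕ) [NeZero p] (m : ℕ) : MonoidAlgebra ℂ (ColoredPerm n p) :=
  ∑ i ∈ Finset.range (ell n p + 1), (u n p i (ell n p - m) : ℂ) • D n p i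

/-- The element `S = ∑ σ, P(shuffle = σ) σ` of the group algebra. -/
noncomputable def S (b n p : ℕ) [NeZero b] [NeZero p] : MonoidAlgebra ℂ (ColoredPerm n p) :=
  ∑ σ : ColoredPerm n p, MonoidAlgebra.single σ ((law b n p σ).toReal : ℂ)

/-- The element `T = ∑ σ, P(shuffle⁻¹ = σ) σ` of the group algebra. -/
noncomputable def T (b n p : ℕ) [NeZero b] [NeZero p] : MonoidAlgebra ℂ (ColoredPerm n p) :=
  ∑ σ : ColoredPerm n p,
    MonoidAlgebra.single σ ((((law b n p).map (fun s => s⁻¹)) σ).toReal : ℂ)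

/-- The coordinates of an element of the group algebra: `∑ x(σ) σ` is identified with the
vector `(x(σ))_σ`. -/
noncomputable def coords (n p : ℕ) [NeZero p] :
    MonoidAlgebra ℂ (ColoredPerm n p) ≃ₗ[ℂ] (ColoredPerm n p → ℂ) :=
  (MonoidAlgebra.coeffLinearEquiv ℂ).trans
    (Finsupp.linearEquivFunOnFinite ℂ ℂ (ColoredPerm n p))

/-- The range of the left regular representation `L(a) : x ↦ a x` of an element `a` of the group
algebra, as a space of vectors indexed by the group. -/
noncomputable def rangeL (a : MonoidAlgebra ℂ (ColoredPerm n p)) :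
    Submodule ℂ (ColoredPerm n p → ℂ) :=
  (LinearMap.range (LinearMap.mulLeft ℂ a)).map (coords n p).toLinearMap

/-- The left eigenspace of a matrix: the row vectors `x` with `x M = lam x`. -/
def leftEigenspace {ι : Type} [Fintype ι] (M : Matrix ι ι ℂ) (lam : ℂ) : Submodule ℂ (ι → ℂ) :=
  Module.End.eigenspace (Matrix.vecMulLinear M) lam

/-- The right eigenspace of a matrix: the column vectors `y` with `M y = lam y`. -/
def rightEigenspace {ι : Type} [Fintype ι] (M : Matrix ι ι ℂ) (lam : ℂ) : Submodule ℂ (ι → ℂ) :=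
  Module.End.eigenspace (Matrix.mulVecLin M) lam

/-- The Stirling–Frobenius cycle numbers of parameter `p`:
`c(n+1, k) = c(n, k-1) + (p (n+1) - 1) c(n, k)`, with `c(0, 0) = 1` and `c(0, k) = 0` for `k ≠ 0`. -/
def stirlingFrobeniusCycle (p : ℕ) : ℕ → ℕ → ℕ
  | 0, 0 => 1
  | 0, _ + 1 => 0
  | n + 1, 0 => (p * (n + 1) - 1) * stirlingFrobeniusCycle p n 0
  | n + 1, k + 1 =>
      stirlingFrobeniusCycle p n k + (p * (n + 1) - 1) * stirlingFrobeniusCycle p n (k + 1)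

end Shuffle

namespace ColoredPerm

theorem apply_add {n p : ℕ} [NeZero p] (σ : ColoredPerm n p) (i : Fin n) (r : ZMod p) :
    σ.1 (i, r) = ((σ.1 (i, 0)).1, (σ.1 (i, 0)).2 + r) := by
  have h : ∀ x : Fin n × ZMod p, σ.1 (x.1, x.2 + 1) = ((σ.1 x).1, (σ.1 x).2 + 1) := fun x =>
    DFunLike.congr_fun (Subgroup.mem_centralizer_singleton_iff.1 σ.2) x
  have key : ∀ k : ℕ, σ.1 (i, (k : ZMod p)) = ((σ.1 (i, 0)).1, (σ.1 (i, 0)).2 + k) := by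
    intro k
    induction k with
    | zero => simp
    | succ k ih =>
      have := h (i, (k : ZMod p))
      rw [ih] at this
      push_cast
      rw [this, add_assoc]
  have := key r.val
  rwa [ZMod.natCast_zmod_val] at this

theorem inv_apply_eq_iff {n p : ℕ} (σ : ColoredPerm n p) (x y : Fin n × ZMod p) :
    (σ⁻¹).1 x = y ↔ x = σ.1 y := by
  change σ.1⁻¹ x = y ↔ _
  exact Equiv.Perm.inv_eq_iff_eq

theorem ext_zero {n p : ℕ} [NeZero p] {σ τ : ColoredPerm n p}
    (h : ∀ i, σ.1 (i, 0) = τ.1 (i, 0)) : σ = τ := by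
  ext1; ext1 ⟨i, r⟩
  rw [apply_add σ, apply_add τ, h]

/-- The permutation of `Fin n` and the colors determine a colored permutation. -/
def ofPermColor {n p : ℕ} (s : Equiv.Perm (Fin n)) (c : Fin n → ZMod p) : ColoredPerm n p :=
  ⟨{ toFun := fun x => (s x.1, x.2 + c x.1)
     invFun := fun y => (s.symm y.1, y.2 - c (s.symm y.1))
     left_inv := fun x => by simp
     right_inv := fun y => by simp },
   by
    rw [coloredPermGroup, Subgroup.mem_centralizer_singleton_iff]
    ext x
    · simp [colorShift]
    · simp [colorShift, add_right_comm]⟩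

/-- The permutation of `Fin n` under a colored permutation. -/
def basePerm {n p : ℕ} [NeZero p] (σ : ColoredPerm n p) : Equiv.Perm (Fin n) where
  toFun i := (σ.1 (i, 0)).1
  invFun i := ((σ⁻¹).1 (i, 0)).1
  left_inv i := by
    rcases h : σ.1 (i, 0) with ⟨j, r⟩
    have h1 := (inv_apply_eq_iff σ _ _).2 h.symm
    rw [apply_add] at h1
    simpa [h] using congrArg Prod.fst h1
  right_inv i := by
    rcases h : (σ⁻¹).1 (i, 0) with ⟨j, r⟩
    have h1 := (inv_apply_eq_iff σ _ _).1 h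
    rw [apply_add] at h1
    change (σ.1 (((σ⁻¹).1 (i, 0)).1, 0)).1 = i
    rw [h]
    exact (congrArg Prod.fst h1).symm

theorem inv_apply_zero {n p : ℕ} [NeZero p] (σ : ColoredPerm n p) (j : Fin n) :
    (σ⁻¹).1 (j, 0) = (σ.basePerm.symm j, -(σ.1 (σ.basePerm.symm j, 0)).2) := by
  rw [inv_apply_eq_iff, apply_add]
  refine Prod.ext (σ.basePerm.apply_symm_apply j).symm ?_
  simp

/-- Colored permutations are pairs of a permutation and a coloring. -/
def equivPermColor (n p : ℕ) [NeZero p] :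
    ColoredPerm n p ≃ Equiv.Perm (Fin n) × (Fin n → ZMod p) where
  toFun σ := (σ.basePerm, fun i => (σ.1 (i, 0)).2)
  invFun x := ofPermColor x.1 x.2
  left_inv σ := ext_zero fun i => by simp [ofPermColor, basePerm]
  right_inv x := by
    ext i
    · simp [ofPermColor, basePerm]
    · simp [ofPermColor]

theorem card_eq (n p : ℕ) [NeZero p] :
    Fintype.card (ColoredPerm n p) = p ^ n * n.factorial := by
  rw [Fintype.card_congr (equivPermColor n p)]
  simp [Fintype.card_perm, mul_comm]

theorem descents_le (n p : ℕ) [NeZero p] (σ : ColoredPerm n p) : σ.descents ≤ n := by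
  classical
  unfold descents
  exact (Finset.card_filter_le _ _).trans (by simp)

theorem descents_le_ell {n p : ℕ} [NeZero p] (hn : 1 ≤ n) (σ : ColoredPerm n p) :
    σ.descents ≤ Shuffle.ell n p := by
  classical
  unfold Shuffle.ell
  split_ifs with hp
  · subst hp
    have : σ.descents < n := by
      have h : σ.descents < (Finset.univ : Finset (Fin n)).card := by
        unfold descents
        refine Finset.card_lt_card
          (Finset.filter_ssubset.2 ⟨⟨n - 1, by omega⟩, Finset.mem_univ _, ?_⟩)
        unfold HasDescent
        rw [dif_neg (by simp; omega)]
        exact not_not.2 (Subsingleton.elim _ _)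
      simpa using h
    omega
  · exact descents_le n p σ

theorem descents_one (n p : ℕ) : (1 : ColoredPerm n p).descents = 0 := by
  classical
  unfold descents
  rw [Finset.card_eq_zero, Finset.filter_eq_empty_iff]
  intro i _
  unfold HasDescent
  split_ifs <;> simp [lt, Fin.lt_def]

end ColoredPerm

theorem Fintype.card_fin_orderEmbedding (n M : ℕ) :
    Fintype.card (Fin n ↪o Fin M) = M.choose n := by
  classical
  have hc : (Finset.powersetCard n (Finset.univ : Finset (Fin M))).card = M.choose n := by simp
  rw [← hc, ← Finset.card_univ]
  refine Finset.card_bij (fun g _ => Finset.univ.map g.toEmbedding) ?_ ?_ ?_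
  · intro g _
    simp [Finset.mem_powersetCard]
  · intro g _ g' _ h
    have hr : Set.range g = Set.range g' := by
      have := congrArg (fun s : Finset (Fin M) => (s : Set (Fin M))) h
      simpa using this
    ext1 i
    exact congrFun ((g.strictMono.range_inj g'.strictMono).1 hr) i
  · intro s hs
    have hs := (Finset.mem_powersetCard.1 hs).2
    refine ⟨s.orderEmbOfFin hs, Finset.mem_univ _, ?_⟩
    rw [← Finset.coe_inj]
    simp

theorem Fin.strictMono_iff_lt_next {n : ℕ} {α : Type*} [Preorder α] {f : Fin n → α} :
    StrictMono f ↔ ∀ (i : Fin n) (h : (i : ℕ) + 1 < n), f i < f ⟨i + 1, h⟩ := by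
  cases n with
  | zero => exact ⟨fun _ i => i.elim0, fun _ i => i.elim0⟩
  | succ n =>
    rw [Fin.strictMono_iff_lt_succ]
    exact ⟨fun h i hi => h ⟨i, by omega⟩, fun h i => h i.castSucc (by simp)⟩

theorem sum_range_one_sub_le (δ : ℕ → ℕ) (j : ℕ) : ∑ k ∈ Finset.range j, (1 - δ k) ≤ j :=
  (Finset.sum_le_card_nsmul _ _ 1 fun k _ => Nat.sub_le 1 (δ k)).trans (by simp)

theorem StrictMono.fin_val_le {n M : ℕ} {g : Fin n → Fin M} (hg : StrictMono g) (i : Fin n) :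
    (i : ℕ) ≤ g i := by
  obtain ⟨i, hi⟩ := i
  induction i with
  | zero => exact Nat.zero_le _
  | succ i ih =>
    exact (Nat.succ_le_succ (ih (by omega))).trans
      (hg (show (⟨i, by omega⟩ : Fin n) < ⟨i + 1, hi⟩ from Fin.mk_lt_mk.2 (by omega)))

/-- Sequences `q 0 ≤ q 1 ≤ ⋯ ≤ q (n - 1) ≤ N` whose successive gaps are at least `δ`, for a
sequence `δ` of zeros and ones, correspond to strictly increasing sequences. -/
def gapSequenceEquiv (n N : ℕ) (δ : ℕ → ℕ) (hδ : ∀ k, δ k ≤ 1) :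
    {q : Fin n → ℕ // ∀ i : Fin n, q i + δ i ≤ if h : (i : ℕ) + 1 < n then q ⟨i + 1, h⟩ else N} ≃
      (Fin n ↪o Fin (N + ∑ k ∈ Finset.range n, (1 - δ k))) where
  toFun q :=
    have hmono : StrictMono fun i : Fin n => q.1 i + ∑ k ∈ Finset.range i, (1 - δ k) :=
      Fin.strictMono_iff_lt_next.2 fun i h => by
        have h1 := q.2 i
        have h2 := hδ i
        rw [dif_pos h] at h1
        simp only [Finset.sum_range_succ]
        omega
    OrderEmbedding.ofStrictMono
      (fun i => ⟨q.1 i + ∑ k ∈ Finset.range i, (1 - δ k), by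
        have hi := i.2
        have hle := hmono.monotone (show i ≤ ⟨n - 1, by omega⟩ from Fin.mk_le_mk.2 (by omega))
        have h1 := q.2 ⟨n - 1, by omega⟩
        rw [dif_neg (by simp only; omega)] at h1
        have h2 := hδ (n - 1)
        have h3 := Finset.sum_range_succ (fun k => 1 - δ k) (n - 1)
        rw [Nat.sub_add_cancel (by omega)] at h3
        dsimp only at hle h1
        omega⟩)
      fun _ _ h => hmono h
  invFun g := ⟨fun i => (g i : ℕ) - ∑ k ∈ Finset.range i, (1 - δ k), by
    intro i
    have h1 := sum_range_one_sub_le δ i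
    have h2 := g.strictMono.fin_val_le i
    have h3 := hδ i
    split_ifs with h
    · have h4 : (g i : ℕ) < g ⟨i + 1, h⟩ :=
        g.strictMono (show i < ⟨i + 1, h⟩ from Fin.lt_def.2 (by simp))
      simp only [Finset.sum_range_succ]
      omega
    · have h4 := (g i).2
      have h5 := Finset.sum_range_succ (fun k => 1 - δ k) i
      rw [show (i : ℕ) + 1 = n by omega] at h5
      dsimp only
      omega⟩
  left_inv q := by
    ext i
    exact Nat.add_sub_cancel _ _
  right_inv g := by
    ext i
    exact Nat.sub_add_cancel ((sum_range_one_sub_le δ i).trans (g.strictMono.fin_val_le i))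

theorem mul_add_lex_iff {α : Type*} [LinearOrder α] {p q q' r r' : ℕ} {s s' : α} (hr : r < p)
    (hr' : r' < p) (hs : s ≠ s') [Decidable (r' < r ∨ r' = r ∧ s' < s)] :
    q + (if r' < r ∨ r' = r ∧ s' < s then 1 else 0) ≤ q' ↔
      p * q + r < p * q' + r' ∨ p * q + r = p * q' + r' ∧ s < s' := by
  rcases lt_trichotomy q q' with h | h | h
  · have h1 : p * (q + 1) ≤ p * q' := Nat.mul_le_mul_left p h
    rw [Nat.mul_succ] at h1
    exact iff_of_true (by split_ifs <;> omega) (Or.inl (by omega))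
  · subst h
    have h1 : s < s' ↔ ¬ s' < s := ⟨fun h => h.le.not_gt, fun h => lt_of_le_of_ne (not_lt.1 h) hs⟩
    rw [h1]
    by_cases h2 : s' < s <;> simp only [h2, and_true, and_false, or_false, not_true,
      not_false_iff] <;> split_ifs <;> omega
  · have h1 : p * (q' + 1) ≤ p * q := Nat.mul_le_mul_left p h
    rw [Nat.mul_succ] at h1
    exact iff_of_false (by omega) (by omega)

namespace ColoredPerm

theorem ofLabels_eq_iff {n p b : ℕ} [NeZero p] (σ : ColoredPerm n p) (A : Fin n → Fin b) :
    ofLabels p A = σ ↔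
      (∀ j, (A (σ.basePerm.symm j) : ℕ) % p = (σ.1 (σ.basePerm.symm j, 0)).2.val) ∧
      StrictMono fun j => toLex ((A (σ.basePerm.symm j) : ℕ), σ.basePerm.symm j) := by
  have h1 : ofLabels p A = σ ↔ σ.basePerm.symm = Tuple.sort A ∧
      ∀ i, ((A i : ℕ) : ZMod p) = (σ.1 (i, 0)).2 := by
    constructor
    · rintro rfl
      refine ⟨?_, fun i => by simp [ofLabels]⟩
      rw [Equiv.symm_eq_iff_trans_eq_refl]
      ext i
      simp [ofLabels, basePerm]
    · rintro ⟨h1, h2⟩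
      refine ext_zero fun i => ?_
      have h3 : (Tuple.sort A).symm i = (σ.1 (i, 0)).1 := by
        rw [← h1]; rfl
      simp [ofLabels, h2, h3]
  have h2 : ∀ (a : ℕ) (c : ZMod p), a % p = c.val ↔ (a : ZMod p) = c := fun a c => by
    rw [← ZMod.val_natCast, (ZMod.val_injective p).eq_iff]
  rw [h1, Tuple.eq_sort_iff, and_comm]
  simp only [h2]
  refine and_congr (σ.basePerm.symm.forall_congr_left.trans (by simp)).symm ?_
  simp only [StrictMono, Prod.Lex.toLex_lt_toLex]
  constructor
  · rintro ⟨hm, ht⟩ i j hij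
    rcases (hm hij.le).lt_or_eq with h | h
    · exact Or.inl h
    · exact Or.inr ⟨congrArg Fin.val h, ht i j hij h⟩
  · intro h
    refine ⟨monotone_iff_forall_lt.2 fun i j hij => ?_, fun i j hij he => ?_⟩
    · rcases h hij with h' | h'
      · exact Fin.le_def.2 h'.le
      · exact Fin.le_def.2 h'.1.le
    · rcases h hij with h' | h'
      · exact absurd (congrArg Fin.val he) h'.ne
      · exact h'.2

open Classical in
theorem card_ofLabels_eq {n p : ℕ} [NeZero p] (N : ℕ) (σ : ColoredPerm n p) :
    Fintype.card {A : Fin n → Fin (p * N + 1) // ofLabels p A = σ} =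
      (n + N - (σ⁻¹).descents).choose n := by
  set s := σ.basePerm.symm with hs
  set r : Fin n → ℕ := fun j => (σ.1 (s j, 0)).2.val with hr
  have hrp : ∀ j, r j < p := fun j => ZMod.val_lt _
  set δ : ℕ → ℕ := fun k => if h : k < n then if (σ⁻¹).HasDescent ⟨k, h⟩ then 1 else 0 else 0 with hδ
  have hδ1 : ∀ k, δ k ≤ 1 := fun k => by simp only [hδ]; split_ifs <;> omega
  have hd : ∑ k ∈ Finset.range n, (1 - δ k) = n - (σ⁻¹).descents := by
    have h1 : (σ⁻¹).descents = ∑ k ∈ Finset.range n, δ k := by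
      rw [Finset.sum_range, descents, Finset.card_filter]
      simp [hδ]
    have h2 : ∑ k ∈ Finset.range n, (1 - δ k) + ∑ k ∈ Finset.range n, δ k = n := by
      rw [← Finset.sum_add_distrib, Finset.sum_congr rfl fun k _ => Nat.sub_add_cancel (hδ1 k)]
      simp
    omega
  have hdn := descents_le n p σ⁻¹
  have hδ_next : ∀ (i : Fin n) (h : (i : ℕ) + 1 < n), δ i =
      if r ⟨i + 1, h⟩ < r i ∨ r ⟨i + 1, h⟩ = r i ∧ s ⟨i + 1, h⟩ < s i then 1 else 0 := by
    intro i h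
    simp only [hδ, i.2, dif_pos, HasDescent, h, lt, inv_apply_zero, neg_neg, neg_inj, hr,
      (ZMod.val_injective p).eq_iff]
    rfl
  have hδ_last : ∀ i : Fin n, ¬ (i : ℕ) + 1 < n → δ i = if r i = 0 then 0 else 1 := by
    intro i h
    simp only [hδ, i.2, dif_pos, HasDescent, h, inv_apply_zero, hr, ZMod.val_eq_zero]
    simp [hs]
  have hchain : ∀ q : Fin n → ℕ,
      (∀ i : Fin n, q i + δ i ≤ if h : (i : ℕ) + 1 < n then q ⟨i + 1, h⟩ else N) ↔
      (StrictMono fun j => toLex (p * q j + r j, s j)) ∧ ∀ j, p * q j + r j < p * N + 1 := by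
    intro q
    have hm : (StrictMono fun j => toLex (p * q j + r j, s j)) ↔
        ∀ (i : Fin n) (h : (i : ℕ) + 1 < n), q i + δ i ≤ q ⟨i + 1, h⟩ := by
      rw [Fin.strictMono_iff_lt_next]
      refine forall₂_congr fun i h => ?_
      rw [hδ_next i h, mul_add_lex_iff (hrp _) (hrp _)
        (s.injective.ne (Fin.ne_of_val_ne (by simp))), Prod.Lex.toLex_lt_toLex]
    have hl : ∀ i : Fin n, ¬ (i : ℕ) + 1 < n →
        (q i + δ i ≤ N ↔ p * q i + r i < p * N + 1) := by
      intro i h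
      have h1 := hrp i
      rw [hδ_last i h]
      rcases lt_trichotomy (q i) N with h | h | h
      · have h2 : p * (q i + 1) ≤ p * N := Nat.mul_le_mul_left p h
        rw [Nat.mul_succ] at h2
        split_ifs <;> omega
      · rw [h]
        split_ifs <;> omega
      · have h2 : p * (N + 1) ≤ p * q i := Nat.mul_le_mul_left p h
        rw [Nat.mul_succ] at h2
        split_ifs <;> omega
    constructor
    · intro h
      have hsm := hm.2 fun i hi => by simpa [hi] using h i
      refine ⟨hsm, fun j => ?_⟩
      have hj := j.2
      have h1 := hsm.monotone (show j ≤ ⟨n - 1, by omega⟩ from Fin.mk_le_mk.2 (by omega))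
      have hlast : ¬ ((⟨n - 1, by omega⟩ : Fin n) : ℕ) + 1 < n := by simp only; omega
      have h2 := h ⟨n - 1, by omega⟩
      rw [dif_neg hlast, hl _ hlast] at h2
      have h3 := (Prod.Lex.toLex_le_toLex.1 h1)
      dsimp only at h3
      omega
    · rintro ⟨h1, h2⟩ i
      split_ifs with h
      · exact hm.1 h1 i h
      · exact (hl i h).2 (h2 i)
  have hA : {A : Fin n → Fin (p * N + 1) // ofLabels p A = σ} ≃ {q : Fin n → ℕ //
      ∀ i : Fin n, q i + δ i ≤ if h : (i : ℕ) + 1 < n then q ⟨i + 1, h⟩ else N} :=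
    { toFun := fun A => ⟨fun j => (A.1 (s j) : ℕ) / p, by
        obtain ⟨h1, h2⟩ := (ofLabels_eq_iff σ A.1).1 A.2
        have h3 : ∀ j, p * ((A.1 (s j) : ℕ) / p) + r j = A.1 (s j) := fun j => by
          have h4 : r j = (A.1 (s j) : ℕ) % p := (h1 j).symm
          rw [h4]
          exact Nat.div_add_mod _ _
        rw [hchain]
        simp only [h3]
        exact ⟨h2, fun j => (A.1 (s j)).2⟩⟩
      invFun := fun q => ⟨fun i => ⟨p * q.1 (s.symm i) + r (s.symm i), ((hchain q.1).1 q.2).2 _⟩, by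
        rw [ofLabels_eq_iff]
        refine ⟨fun j => ?_, ?_⟩
        · simp only [← hs, Equiv.symm_apply_apply, Nat.mul_add_mod, Nat.mod_eq_of_lt (hrp j)]
          rfl
        · simp only [← hs, Equiv.symm_apply_apply]
          exact ((hchain q.1).1 q.2).1⟩
      left_inv := fun A => by
        obtain ⟨h1, h2⟩ := (ofLabels_eq_iff σ A.1).1 A.2
        ext i
        have h3 := h1 (s.symm i)
        rw [← hs, Equiv.apply_symm_apply] at h3
        simp only [hr, Equiv.apply_symm_apply, ← h3]
        exact Nat.div_add_mod _ _
      right_inv := fun q => by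
        ext j
        simp only [Equiv.symm_apply_apply]
        rw [Nat.mul_add_div (NeZero.pos p), Nat.div_eq_of_lt (hrp j), add_zero] }
  rw [Fintype.card_congr (hA.trans (gapSequenceEquiv n N δ hδ1)), Fintype.card_fin_orderEmbedding,
    hd]
  congr 1
  omega

end ColoredPerm

namespace Shuffle

open ColoredPerm

variable {n p : ℕ} [NeZero p]

open Classical in
theorem law_toReal (b n p : ℕ) [NeZero b] [NeZero p] (σ : ColoredPerm n p) :
    (law b n p σ).toReal =
      Fintype.card {A : Fin n → Fin b // ofLabels p A = σ} / (b : ℝ) ^ n := by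
  rw [law, PMF.map_apply, tsum_fintype]
  simp only [PMF.uniformOfFintype_apply, ← Finset.sum_filter, Finset.sum_const, nsmul_eq_mul,
    ENNReal.toReal_mul, ENNReal.toReal_inv, ENNReal.toReal_natCast, Fintype.card_fun,
    Fintype.card_fin, Nat.cast_pow, Fintype.card_subtype, div_eq_mul_inv, eq_comm (a := σ),
    ENNReal.toReal_pow]

theorem law_map_inv (b n p : ℕ) [NeZero b] (σ : ColoredPerm n p) :
    ((law b n p).map fun s => s⁻¹) σ = law b n p σ⁻¹ := by
  classical
  rw [PMF.map_apply, tsum_eq_single σ⁻¹]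
  · simp
  · intro τ hτ
    rw [if_neg]
    rintro rfl
    exact hτ (inv_inv τ).symm

theorem transition_apply (b n p : ℕ) [NeZero b] (μ τ : ColoredPerm n p) :
    transition b n p μ τ = ((law b n p (τ * μ⁻¹)).toReal : ℂ) := by
  classical
  simp only [transition, Matrix.of_apply, step]
  rw [PMF.map_apply, tsum_eq_single (τ * μ⁻¹)]
  · simp
  · intro s hs
    rw [if_neg]
    rintro rfl
    exact hs (by simp)

theorem natDegree_binomPoly_le (n p i : ℕ) : (binomPoly n p i).natDegree ≤ n := by
  unfold binomPoly
  refine (Polynomial.natDegree_C_mul_le _ _).trans ((Polynomial.natDegree_prod_le _ _).trans ?_)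
  refine (Finset.sum_le_card_nsmul _ _ 1 fun m _ => ?_).trans (by simp)
  compute_degree

theorem eval_binomPoly (n p i : ℕ) (x : ℚ) :
    (binomPoly n p i).eval x =
      (1 / (n.factorial : ℚ)) * ∏ m ∈ Finset.range n, (n + 1 / (p : ℚ) * (x - 1) - i - m) := by
  simp [binomPoly, Polynomial.eval_prod]

theorem eval_binomPoly_eq_choose {i : ℕ} (hi : i ≤ n) (N : ℕ) :
    (binomPoly n p i).eval ((p * N + 1 : ℕ) : ℚ) = ((n + N - i).choose n : ℕ) := by
  have hp : (p : ℚ) ≠ 0 := Nat.cast_ne_zero.2 (NeZero.ne p)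
  have h1 : (n : ℚ) + 1 / (p : ℚ) * (((p * N + 1 : ℕ) : ℚ) - 1) - i = ((n + N - i : ℕ) : ℚ) := by
    rw [Nat.cast_sub (by omega)]
    push_cast
    field_simp
    ring
  rw [eval_binomPoly, h1, ← descPochhammer_eval_eq_prod_range,
    descPochhammer_eval_eq_descFactorial, Nat.descFactorial_eq_factorial_mul_choose]
  have := n.factorial_ne_zero
  push_cast
  field_simp

theorem coeff_binomPoly_eq_zero {i k : ℕ} (hi : i ≤ ell n p) (hn : 1 ≤ n) (hk : ell n p < k)
    (hkn : k ≤ n) : (binomPoly n p i).coeff (n - k) = 0 := by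
  unfold ell at hi hk
  split_ifs at hi hk with hp
  · subst hp
    rw [show n - k = 0 by omega, Polynomial.coeff_zero_eq_eval_zero, eval_binomPoly]
    refine mul_eq_zero_of_right _ (Finset.prod_eq_zero (i := n - 1 - i)
      (Finset.mem_range.2 (by omega)) ?_)
    rw [Nat.cast_sub hi, Nat.cast_sub hn]
    push_cast
    ring
  · omega

theorem choose_div_pow_eq_sum {i : ℕ} (hn : 1 ≤ n) (hi : i ≤ ell n p) (N : ℕ) :
    ((n + N - i).choose n : ℚ) / ((p * N + 1 : ℕ) : ℚ) ^ n =
      ∑ k ∈ Finset.range (ell n p + 1), (((p * N + 1 : ℕ) : ℚ) ^ k)⁻¹ * u n p i k := by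
  have hl : ell n p ≤ n := by unfold ell; split_ifs <;> omega
  have hb : ((p * N + 1 : ℕ) : ℚ) ≠ 0 := Nat.cast_ne_zero.2 (Nat.succ_ne_zero _)
  rw [← eval_binomPoly_eq_choose (p := p) (hi.trans hl),
    Polynomial.eval_eq_sum_range' (Nat.lt_succ_of_le (natDegree_binomPoly_le n p i)),
    ← Finset.sum_range_reflect, Finset.sum_div]
  symm
  refine Finset.sum_subset_zero_on_sdiff (Finset.range_subset_range.2 (by omega)) ?_ ?_
  · intro k hk
    simp only [Finset.mem_sdiff, Finset.mem_range] at hk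
    rw [show n + 1 - 1 - k = n - k by omega,
      coeff_binomPoly_eq_zero hi hn (by omega) (by omega), zero_mul, zero_div]
  · intro k hk
    have hk := Finset.mem_range.1 hk
    rw [show n + 1 - 1 - k = n - k by omega, u, eq_div_iff (pow_ne_zero _ hb)]
    nth_rewrite 3 [← Nat.sub_add_cancel (show k ≤ n by omega)]
    rw [pow_add]
    field_simp

theorem coeff_sum_single_filter (P : ColoredPerm n p → Prop) [DecidablePred P]
    (σ : ColoredPerm n p) :
    (∑ τ ∈ Finset.univ.filter P, MonoidAlgebra.single τ (1 : ℂ)).coeff σ =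
      if P σ then 1 else 0 := by
  classical
  simp [MonoidAlgebra.coeff_sum, Finsupp.finsetSum_apply, Finsupp.single_apply]

theorem coeff_sum_single (g : ColoredPerm n p → ℂ) (σ : ColoredPerm n p) :
    (∑ τ, MonoidAlgebra.single τ (g τ)).coeff σ = g σ := by
  classical
  simp [MonoidAlgebra.coeff_sum, Finsupp.finsetSum_apply, Finsupp.single_apply]

theorem coeff_e (hn : 1 ≤ n) {k : ℕ} (hk : k ≤ ell n p) (σ : ColoredPerm n p) :
    (e n p (ell n p - k)).coeff σ = (u n p σ⁻¹.descents k : ℂ) := by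
  classical
  rw [e, Nat.sub_sub_self hk]
  simp only [MonoidAlgebra.coeff_sum, Finsupp.finsetSum_apply, MonoidAlgebra.coeff_smul_apply]
  simp only [Theta, coeff_sum_single_filter, smul_eq_mul, mul_ite, mul_one, mul_zero]
  rw [Finset.sum_ite_eq, if_pos (Finset.mem_range.2 (Nat.lt_succ_of_le (descents_le_ell hn _)))]

theorem coeff_f (hn : 1 ≤ n) {k : ℕ} (hk : k ≤ ell n p) (σ : ColoredPerm n p) :
    (f n p (ell n p - k)).coeff σ = (u n p σ.descents k : ℂ) := by
  classical
  rw [f, Nat.sub_sub_self hk]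
  simp only [MonoidAlgebra.coeff_sum, Finsupp.finsetSum_apply, MonoidAlgebra.coeff_smul_apply]
  simp only [D, coeff_sum_single_filter, smul_eq_mul, mul_ite, mul_one, mul_zero]
  rw [Finset.sum_ite_eq, if_pos (Finset.mem_range.2 (Nat.lt_succ_of_le (descents_le_ell hn _)))]

theorem law_eq_sum (hn : 1 ≤ n) {b : ℕ} [NeZero b] (hbp : b ≡ 1 [MOD p]) (σ : ColoredPerm n p) :
    ((law b n p σ).toReal : ℂ) =
      ∑ k ∈ Finset.range (ell n p + 1), ((b : ℂ) ^ k)⁻¹ * (u n p σ⁻¹.descents k : ℂ) := by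
  obtain ⟨N, rfl⟩ : ∃ N, b = p * N + 1 := by
    obtain ⟨N, hN⟩ := (Nat.modEq_iff_dvd' (NeZero.one_le (n := b))).1 hbp.symm
    exact ⟨N, by have := NeZero.one_le (n := b); omega⟩
  rw [law_toReal, card_ofLabels_eq]
  have := congrArg (fun x : ℚ => (x : ℂ))
    (choose_div_pow_eq_sum (p := p) hn (descents_le_ell hn σ⁻¹) N)
  push_cast at this ⊢
  exact this

theorem S_eq_sum (hn : 1 ≤ n) {b : ℕ} [NeZero b] (hbp : b ≡ 1 [MOD p]) :
    S b n p = ∑ k ∈ Finset.range (ell n p + 1), ((b : ℂ) ^ k)⁻¹ • e n p (ell n p - k) := by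
  ext σ
  rw [S, coeff_sum_single, law_eq_sum hn hbp]
  simp only [MonoidAlgebra.coeff_sum, Finsupp.finsetSum_apply, MonoidAlgebra.coeff_smul_apply]
  refine Finset.sum_congr rfl fun k hk => ?_
  rw [coeff_e hn (Nat.lt_succ_iff.1 (Finset.mem_range.1 hk)), smul_eq_mul]

theorem T_eq_sum (hn : 1 ≤ n) {b : ℕ} [NeZero b] (hbp : b ≡ 1 [MOD p]) :
    T b n p = ∑ k ∈ Finset.range (ell n p + 1), ((b : ℂ) ^ k)⁻¹ • f n p (ell n p - k) := by
  ext σ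
  rw [T, coeff_sum_single, law_map_inv, law_eq_sum hn hbp, inv_inv]
  simp only [MonoidAlgebra.coeff_sum, Finsupp.finsetSum_apply, MonoidAlgebra.coeff_smul_apply]
  refine Finset.sum_congr rfl fun k hk => ?_
  rw [coeff_f hn (Nat.lt_succ_iff.1 (Finset.mem_range.1 hk)), smul_eq_mul]

theorem S_eq_smul_sum (b : ℕ) [NeZero b] :
    S b n p = ((b : ℂ) ^ n)⁻¹ • ∑ A : Fin n → Fin b, MonoidAlgebra.single (ofLabels p A) 1 := by
  classical
  ext σ
  rw [S, coeff_sum_single, law_toReal]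
  simp [MonoidAlgebra.coeff_sum, Finsupp.single_apply,
    Fintype.card_subtype, div_eq_inv_mul]

theorem ofLabels_mul {a b : ℕ} (hbp : b ≡ 1 [MOD p]) (A : Fin n → Fin a) (B : Fin n → Fin b) :
    ofLabels p (A ∘ Tuple.sort B) * ofLabels p B =
      ofLabels p fun i => finProdFinEquiv (A i, B i) := by
  set C : Fin n → Fin (a * b) := fun i => finProdFinEquiv (A i, B i) with hC
  have hsort : (Tuple.sort (A ∘ Tuple.sort B)).trans (Tuple.sort B) = Tuple.sort C := by
    obtain ⟨hA1, hA2⟩ := Tuple.eq_sort_iff.1 (Eq.refl (Tuple.sort (A ∘ Tuple.sort B)))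
    obtain ⟨hB1, hB2⟩ := Tuple.eq_sort_iff.1 (Eq.refl (Tuple.sort B))
    have hval : ∀ i, (C i : ℕ) = B i + b * A i := fun i => rfl
    rw [Tuple.eq_sort_iff]
    refine ⟨monotone_iff_forall_lt.2 fun i j hij => ?_, fun i j hij h => ?_⟩
    · rw [Fin.le_def]
      simp only [Function.comp_apply, Equiv.trans_apply, hval]
      rcases (hA1 hij.le).lt_or_eq with h | h
      · have h1 := Nat.mul_le_mul_left b (Nat.succ_le_of_lt (Fin.lt_def.1 h))
        rw [Nat.mul_succ] at h1
        simp only [Function.comp_apply] at h1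
        have h2 := (B (Tuple.sort B (Tuple.sort (A ∘ Tuple.sort B) i))).2
        omega
      · have h1 := Fin.le_def.1 (hB1 (hA2 i j hij h).le)
        simp only [Function.comp_apply] at h h1
        rw [h]
        omega
    · have h1 := finProdFinEquiv.injective h
      exact hB2 _ _ (hA2 i j hij (congrArg Prod.fst h1)) (congrArg Prod.snd h1)
  refine ext_zero fun i => Prod.ext ?_ ?_
  · exact congrArg (fun s : Equiv.Perm (Fin n) => s.symm i) hsort
  · have hb : (b : ZMod p) = 1 := by
      simpa using (ZMod.natCast_eq_natCast_iff b 1 p).2 hbp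
    simp [ofLabels, hb, hC]

theorem S_mul_S {a b : ℕ} [NeZero a] [NeZero b] (hbp : b ≡ 1 [MOD p]) :
    S a n p * S b n p = S (a * b) n p := by
  simp only [S_eq_smul_sum, smul_mul_smul_comm, Finset.sum_mul_sum, MonoidAlgebra.single_mul_single,
    mul_one]
  congr 1
  · push_cast
    rw [mul_pow, mul_inv]
  · rw [Finset.sum_comm]
    have h1 : ∀ B : Fin n → Fin b,
        ∑ A : Fin n → Fin a, MonoidAlgebra.single (ofLabels p A * ofLabels p B) (1 : ℂ) =
        ∑ A : Fin n → Fin a,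
          MonoidAlgebra.single (ofLabels p fun i => finProdFinEquiv (A i, B i)) (1 : ℂ) := by
      intro B
      rw [← ((Tuple.sort B).symm.arrowCongr (Equiv.refl (Fin a))).sum_comp]
      refine Finset.sum_congr rfl fun A _ => ?_
      rw [← ofLabels_mul hbp]
      rfl
    rw [Finset.sum_congr rfl fun B _ => h1 B, Finset.sum_comm, ← Fintype.sum_prod_type']
    exact ((Equiv.arrowProdEquivProdArrow (Fin n) (fun _ => Fin a) (fun _ => Fin b)).symm.trans
      ((Equiv.refl (Fin n)).arrowCongr finProdFinEquiv)).sum_comp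
        (fun C => MonoidAlgebra.single (ofLabels p C) (1 : ℂ))

theorem S_one : S 1 n p = 1 := by
  have h : ∀ A : Fin n → Fin 1, ofLabels p A = 1 := fun A => by
    have : 1 = Tuple.sort A := Tuple.eq_sort_iff.2
      ⟨fun _ _ _ => (Subsingleton.elim _ _).le, fun i j h _ => h⟩
    refine ext_zero fun i => Prod.ext ?_ ?_
    · simp [ofLabels, ← this, ← Equiv.Perm.inv_def]
    · simp [ofLabels]
  rw [S_eq_smul_sum]
  simp [h, MonoidAlgebra.one_def]

end Shuffle

theorem eq_zero_of_forall_sum_pow_smul_eq_zero {V : Type*} [AddCommGroup V] [Module ℂ V] {m : ℕ}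
    (v : Fin m → V) {z : ℕ → ℂ} (hz : Function.Injective z)
    (h : ∀ t, ∑ k : Fin m, z t ^ (k : ℕ) • v k = 0) (k : Fin m) : v k = 0 := by
  rw [← Module.forall_dual_apply_eq_zero_iff ℂ]
  intro φ
  have h0 : (∑ k : Fin m, Polynomial.monomial (k : ℕ) (φ (v k))) = 0 := by
    refine Polynomial.eq_zero_of_infinite_isRoot _ ((Set.infinite_range_of_injective hz).mono ?_)
    rintro _ ⟨t, rfl⟩
    have := congrArg φ (h t)
    simp only [map_sum, map_smul, smul_eq_mul, map_zero] at this
    simpa [Polynomial.IsRoot, Polynomial.eval_finsetSum, mul_comm] using this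
  simpa [Polynomial.finsetSum_coeff, Polynomial.coeff_monomial, Fin.val_inj] using
    congrArg (fun P : Polynomial ℂ => P.coeff k) h0

/-- A multiplicative family of elements that are polynomials in a parameter decomposes `1` into
orthogonal idempotents. -/
theorem completeOrthogonalIdempotents_of_sum_pow_smul {A : Type*} [Ring A] [Algebra ℂ A] {m : ℕ}
    (E : Fin m → A) {z : ℕ → ℂ} (hz : Function.Injective z) (S : ℕ → A)
    (hS : ∀ t, S t = ∑ k : Fin m, z t ^ (k : ℕ) • E k) (hz0 : z 0 = 1) (hS0 : S 0 = 1)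
    (hmul : ∀ s t, ∃ r, z r = z s * z t ∧ S s * S t = S r) : CompleteOrthogonalIdempotents E := by
  have h1 : ∀ s k, S s * E k = z s ^ (k : ℕ) • E k := by
    intro s k
    refine sub_eq_zero.1 (eq_zero_of_forall_sum_pow_smul_eq_zero
      (fun k : Fin m => S s * E k - z s ^ (k : ℕ) • E k) hz (fun t => ?_) k)
    obtain ⟨r, hr, hSr⟩ := hmul s t
    rw [hS t, hS r, Finset.mul_sum] at hSr
    simp only [smul_sub, Finset.sum_sub_distrib, ← mul_smul_comm, hSr, hr, mul_pow, smul_smul]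
    rw [sub_eq_zero]
    exact Finset.sum_congr rfl fun k _ => by rw [mul_comm]
  have h2 : ∀ j k, E j * E k = if j = k then E k else 0 := by
    intro j k
    refine sub_eq_zero.1 (eq_zero_of_forall_sum_pow_smul_eq_zero
      (fun j : Fin m => E j * E k - if j = k then E k else 0) hz (fun t => ?_) j)
    have h3 := h1 t k
    rw [hS t, Finset.sum_mul] at h3
    simp only [smul_sub, Finset.sum_sub_distrib, ← smul_mul_assoc, h3]
    simp
  refine ⟨⟨fun k => ?_, fun j k hjk => ?_⟩, ?_⟩
  · rw [IsIdempotentElem, h2, if_pos rfl]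
  · exact (h2 j k).trans (if_neg hjk)
  · simpa [hz0, hS0] using (hS 0).symm

theorem CompleteOrthogonalIdempotents.mul_eq_of_forall_ne {A ι : Type*} [Ring A] [Fintype ι]
    {E : ι → A} (hE : CompleteOrthogonalIdempotents E)
    {i : ι} {x : A} (h : ∀ k, k ≠ i → E k * x = 0) : E i * x = x := by
  classical
  conv_rhs => rw [← one_mul x, ← hE.complete, Finset.sum_mul]
  rw [Finset.sum_eq_single i (fun k _ hk => h k hk) (fun h => absurd (Finset.mem_univ i) h)]

section Eigen

variable {A ι : Type*} [Ring A] [Algebra ℂ A] [Fintype ι] {E : ι → A}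

theorem OrthogonalIdempotents.mul_sum_smul (hE : OrthogonalIdempotents E) (c : ι → ℂ) (i : ι) :
    E i * ∑ k, c k • E k = c i • E i := by
  classical
  simp [Finset.mul_sum, hE.mul_eq]

theorem OrthogonalIdempotents.sum_smul_mul (hE : OrthogonalIdempotents E) (c : ι → ℂ) (i : ι) :
    (∑ k, c k • E k) * E i = c i • E i := by
  classical
  simp [Finset.sum_mul, hE.mul_eq]

theorem OrthogonalIdempotents.mul_mulLeft_sub_pow (hE : OrthogonalIdempotents E) (c : ι → ℂ)
    (lam : ℂ) (i : ι) (m : ℕ) (x : A) :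
    E i * ((LinearMap.mulLeft ℂ (∑ k, c k • E k) - lam • (1 : Module.End ℂ A)) ^ m) x =
      (c i - lam) ^ m • (E i * x) := by
  induction m generalizing x with
  | zero => simp
  | succ m ih =>
    rw [pow_succ, Module.End.mul_apply, ih]
    simp [mul_sub, ← mul_assoc, hE.mul_sum_smul, pow_succ, sub_smul, mul_smul, smul_sub]

theorem CompleteOrthogonalIdempotents.maxGenEigenspace_mulLeft
    (hE : CompleteOrthogonalIdempotents E) {c : ι → ℂ} (hc : Function.Injective c) (i : ι) :
    Module.End.maxGenEigenspace (LinearMap.mulLeft ℂ (∑ k, c k • E k)) (c i) =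
      LinearMap.range (LinearMap.mulLeft ℂ (E i)) := by
  refine le_antisymm (fun x hx => ?_) ?_
  · obtain ⟨m, hm⟩ := (Module.End.mem_maxGenEigenspace _ _ _).1 hx
    refine ⟨x, hE.mul_eq_of_forall_ne fun k hk => ?_⟩
    have h := hE.toOrthogonalIdempotents.mul_mulLeft_sub_pow c (c i) k m x
    rw [hm, mul_zero, eq_comm, smul_eq_zero] at h
    exact h.resolve_left (pow_ne_zero _ (sub_ne_zero.2 (hc.ne hk)))
  · rintro _ ⟨x, rfl⟩
    refine (Module.End.mem_maxGenEigenspace _ _ _).2 ⟨1, ?_⟩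
    simp [← mul_assoc, hE.toOrthogonalIdempotents.sum_smul_mul]

theorem CompleteOrthogonalIdempotents.eigenspace_mulLeft
    (hE : CompleteOrthogonalIdempotents E) {c : ι → ℂ} (hc : Function.Injective c) (i : ι) :
    Module.End.eigenspace (LinearMap.mulLeft ℂ (∑ k, c k • E k)) (c i) =
      LinearMap.range (LinearMap.mulLeft ℂ (E i)) := by
  refine le_antisymm ?_ ?_
  · rw [← hE.maxGenEigenspace_mulLeft hc i]
    exact Module.End.genEigenspace_le_maximal _ _ _
  · rintro _ ⟨x, rfl⟩
    rw [Module.End.mem_eigenspace_iff]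
    simp [← mul_assoc, hE.toOrthogonalIdempotents.sum_smul_mul]

theorem CompleteOrthogonalIdempotents.exists_eq_of_hasEigenvalue
    (hE : CompleteOrthogonalIdempotents E) {c : ι → ℂ} {lam : ℂ}
    (h : Module.End.HasEigenvalue (LinearMap.mulLeft ℂ (∑ k, c k • E k)) lam) : ∃ i, lam = c i := by
  obtain ⟨x, hx⟩ := h.exists_hasEigenvector
  by_contra! hne
  refine hx.2 ?_
  rw [← one_mul x, ← hE.complete, Finset.sum_mul]
  refine Finset.sum_eq_zero fun k _ => ?_
  have h1 := hE.toOrthogonalIdempotents.mul_mulLeft_sub_pow c lam k 1 x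
  have h2 := hx.apply_eq_smul
  simp only [pow_one, LinearMap.sub_apply, h2, LinearMap.smul_apply, Module.End.one_apply, sub_self,
    mul_zero] at h1
  exact (smul_eq_zero.1 h1.symm).resolve_left (sub_ne_zero.2 (hne k).symm)

end Eigen

theorem Module.End.eigenspace_conj {K V W : Type*} [CommRing K] [AddCommGroup V] [Module K V]
    [AddCommGroup W] [Module K W] (φ : V ≃ₗ[K] W) (g : Module.End K V) (lam : K) :
    Module.End.eigenspace (φ.conj g) lam = (Module.End.eigenspace g lam).map φ.toLinearMap := by
  ext w
  rw [Module.End.mem_eigenspace_iff, Submodule.mem_map]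
  constructor
  · intro h
    refine ⟨φ.symm w, ?_, by simp⟩
    rw [Module.End.mem_eigenspace_iff]
    apply φ.injective
    simpa [LinearEquiv.conj_apply] using h
  · rintro ⟨v, hv, rfl⟩
    rw [Module.End.mem_eigenspace_iff] at hv
    simp [LinearEquiv.conj_apply, hv]

namespace Shuffle

variable {n p : ℕ} [NeZero p]

theorem coeff_prod_eq_stirlingFrobeniusCycle (n p k : ℕ) :
    (∏ m ∈ Finset.range n, (Polynomial.X + Polynomial.C (p * (m + 1) - 1))).coeff k =
      stirlingFrobeniusCycle p n k := by
  induction n generalizing k with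
  | zero => cases k <;> simp [stirlingFrobeniusCycle, Polynomial.coeff_one]
  | succ n ih =>
    rw [Finset.prod_range_succ, mul_add, Polynomial.coeff_add, Polynomial.coeff_mul_C, ih]
    cases k with
    | zero => simp [stirlingFrobeniusCycle, mul_comm]
    | succ k => rw [Polynomial.coeff_mul_X, ih, stirlingFrobeniusCycle, mul_comm]

theorem stirlingFrobeniusCycle_eq_u (n p j : ℕ) [NeZero p] :
    (stirlingFrobeniusCycle p n (n - j) : ℚ) = u n p 0 j * (p : ℚ) ^ n * (n.factorial : ℚ) := by
  have hp : (p : ℚ) ≠ 0 := Nat.cast_ne_zero.2 (NeZero.ne p)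
  have hn : (n.factorial : ℚ) ≠ 0 := Nat.cast_ne_zero.2 n.factorial_ne_zero
  have h : (∏ m ∈ Finset.range n, (Polynomial.X + Polynomial.C (p * (m + 1) - 1))).map
      (Nat.castRingHom ℚ) = Polynomial.C ((p : ℚ) ^ n * n.factorial) * binomPoly n p 0 := by
    rw [binomPoly, ← mul_assoc, ← Polynomial.C_mul, mul_assoc, mul_one_div_cancel hn, mul_one,
      Polynomial.C_pow]
    nth_rewrite 2 [← Finset.card_range n]
    rw [← Finset.prod_const, ← Finset.prod_mul_distrib, ← Finset.prod_range_reflect,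
      Polynomial.map_prod]
    refine Finset.prod_congr rfl fun m hm => ?_
    have hm := Finset.mem_range.1 hm
    have h1 : 1 ≤ p * (n - m) := Nat.mul_pos (NeZero.pos p) (by omega)
    rw [show n - 1 - m + 1 = n - m by omega]
    have h2 : (Polynomial.C (p : ℚ)) * Polynomial.C (1 / (p : ℚ)) = 1 := by
      rw [← Polynomial.C_mul, mul_one_div_cancel hp, Polynomial.C_1]
    have h3 : (Nat.castRingHom ℚ) (p * (n - m) - 1) = (p : ℚ) * (n - m) - 1 := by
      rw [eq_natCast, Nat.cast_sub h1, Nat.cast_mul, Nat.cast_sub hm.le, Nat.cast_one]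
    rw [Polynomial.map_add, Polynomial.map_X, Polynomial.map_C, h3]
    simp only [Polynomial.C_sub, Polynomial.C_mul, Polynomial.C_1, Nat.cast_zero, Polynomial.C_0]
    linear_combination (-(Polynomial.X - 1)) * h2
  have := congrArg (Polynomial.coeff · (n - j)) h
  rw [Polynomial.coeff_map, coeff_prod_eq_stirlingFrobeniusCycle, Polynomial.coeff_C_mul,
    eq_natCast] at this
  rw [this, u]
  ring

theorem stirlingFrobeniusCycle_pos {n p k : ℕ} (hk : k ≤ n)
    (h : 2 ≤ p ∨ p = 1 ∧ 1 ≤ k ∨ p = 1 ∧ n = 0) :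
    0 < stirlingFrobeniusCycle p n k := by
  induction n generalizing k with
  | zero =>
    obtain rfl : k = 0 := by omega
    exact Nat.one_pos
  | succ n ih =>
    cases k with
    | zero =>
      have h2 : 2 ≤ p := by omega
      rw [stirlingFrobeniusCycle]
      refine Nat.mul_pos ?_ (ih (Nat.zero_le _) (Or.inl h2))
      have := Nat.mul_le_mul h2 (Nat.succ_le_succ (Nat.zero_le n))
      simp only [Nat.succ_eq_add_one] at this
      omega
    | succ k =>
      rw [stirlingFrobeniusCycle]
      by_cases h' : 2 ≤ p ∨ p = 1 ∧ 1 ≤ k ∨ p = 1 ∧ n = 0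
      · exact Nat.add_pos_left (ih (by omega) h') _
      · obtain ⟨rfl, hn⟩ : p = 1 ∧ 1 ≤ n := by omega
        exact Nat.add_pos_right _ (Nat.mul_pos (by omega) (ih (by omega) (by omega)))

theorem coords_apply (x : MonoidAlgebra ℂ (ColoredPerm n p)) (σ : ColoredPerm n p) :
    coords n p x σ = x.coeff σ := rfl

theorem coords_conj_mulLeft (x : MonoidAlgebra ℂ (ColoredPerm n p)) :
    (coords n p).conj (LinearMap.mulLeft ℂ x) =
      Matrix.mulVecLin (Matrix.of fun μ τ => x.coeff (μ * τ⁻¹)) := by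
  refine LinearMap.ext fun v => ?_
  obtain ⟨y, rfl⟩ := (coords n p).surjective v
  ext μ
  rw [LinearEquiv.conj_apply_apply, LinearEquiv.symm_apply_apply, LinearMap.mulLeft_apply,
    coords_apply, MonoidAlgebra.coeff_mul_apply_right, Finsupp.sum_fintype _ _ (by simp)]
  rfl

theorem trace_mulLeft (x : MonoidAlgebra ℂ (ColoredPerm n p)) :
    LinearMap.trace ℂ _ (LinearMap.mulLeft ℂ x) = Fintype.card (ColoredPerm n p) * x.coeff 1 := by
  classical
  rw [← LinearMap.trace_conj' _ (coords n p), coords_conj_mulLeft, ← Matrix.toLin'_apply',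
    Matrix.trace_toLin'_eq]
  simp [Matrix.trace]

theorem finrank_range_mulLeft {x : MonoidAlgebra ℂ (ColoredPerm n p)} (hx : IsIdempotentElem x) :
    (Module.finrank ℂ (LinearMap.range (LinearMap.mulLeft ℂ x)) : ℂ) =
      Fintype.card (ColoredPerm n p) * x.coeff 1 := by
  have : FiniteDimensional ℂ (MonoidAlgebra ℂ (ColoredPerm n p)) :=
    (coords n p).symm.finiteDimensional
  have h : IsIdempotentElem (LinearMap.mulLeft ℂ x) := by
    refine LinearMap.ext fun y => ?_
    simp [← mul_assoc, hx.eq]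
  rw [← trace_mulLeft, (LinearMap.IsIdempotentElem.isProj_range _ h).trace]

end Shuffle

namespace Shuffle

open ColoredPerm

variable {n p : ℕ} [NeZero p]

theorem completeOrthogonalIdempotents_e (hn : 1 ≤ n) :
    CompleteOrthogonalIdempotents fun k : Fin (ell n p + 1) => e n p (ell n p - k) := by
  have hmod : ∀ t, p * t + 1 ≡ 1 [MOD p] := fun t => by simp [Nat.ModEq]
  refine completeOrthogonalIdempotents_of_sum_pow_smul _
    (z := fun t => (((p * t + 1 : ℕ) : ℂ))⁻¹) (fun s t h => ?_) (fun t => S (p * t + 1) n p)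
    (fun t => ?_) (by simp) ?_ (fun s t => ⟨p * s * t + s + t, ?_, ?_⟩)
  · have h1 := Nat.cast_injective (inv_injective h)
    exact Nat.eq_of_mul_eq_mul_left (NeZero.pos p) (Nat.succ_injective h1)
  · simp only [S_eq_sum hn (hmod t), Finset.sum_range, inv_pow]
  · simpa using S_one (n := n) (p := p)
  · rw [← mul_inv, ← Nat.cast_mul]
    congr 2
    ring
  · rw [S_mul_S (hmod t)]
    congr 1
    ring

theorem coeff_antipode (x : MonoidAlgebra ℂ (ColoredPerm n p)) (σ : ColoredPerm n p) :
    (HopfAlgebra.antipode ℂ x).coeff σ = x.coeff σ⁻¹ := by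
  classical
  induction x using MonoidAlgebra.induction_linear with
  | zero => simp
  | add x y hx hy => simp [hx, hy]
  | single τ r => simp [Finsupp.single_apply, inv_eq_iff_eq_inv]

theorem antipode_e (hn : 1 ≤ n) {k : ℕ} (hk : k ≤ ell n p) :
    HopfAlgebra.antipode ℂ (e n p (ell n p - k)) = f n p (ell n p - k) := by
  ext σ
  rw [coeff_antipode, coeff_e hn hk, coeff_f hn hk, inv_inv]

theorem completeOrthogonalIdempotents_f (hn : 1 ≤ n) :
    CompleteOrthogonalIdempotents fun k : Fin (ell n p + 1) => f n p (ell n p - k) := by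
  have h := completeOrthogonalIdempotents_e (n := n) (p := p) hn
  have hf : ∀ k : Fin (ell n p + 1),
      f n p (ell n p - k) = HopfAlgebra.antipode ℂ (e n p (ell n p - k)) := fun k =>
    (antipode_e hn (Nat.lt_succ_iff.1 k.2)).symm
  simp only [hf]
  refine ⟨⟨fun k => ?_, fun j k hjk => ?_⟩, ?_⟩
  · rw [IsIdempotentElem, ← HopfAlgebra.antipode_mul_antidistrib, (h.idem k).eq]
  · change HopfAlgebra.antipode ℂ _ * HopfAlgebra.antipode ℂ _ = 0
    rw [← HopfAlgebra.antipode_mul_antidistrib, h.ortho hjk.symm, map_zero]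
  · rw [← map_sum, h.complete, HopfAlgebra.antipode_one]

theorem mulVecLin_transition (b n p : ℕ) [NeZero b] [NeZero p] :
    Matrix.mulVecLin (transition b n p) =
      (coords n p).conj (LinearMap.mulLeft ℂ (T b n p)) := by
  rw [coords_conj_mulLeft]
  congr 1
  ext μ τ
  rw [transition_apply, Matrix.of_apply, T, coeff_sum_single, law_map_inv, mul_inv_rev, inv_inv]

theorem vecMulLinear_transition (b n p : ℕ) [NeZero b] [NeZero p] :
    Matrix.vecMulLinear (transition b n p) =
      (coords n p).conj (LinearMap.mulLeft ℂ (S b n p)) := by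
  rw [coords_conj_mulLeft]
  have h : Matrix.of (fun μ τ => (S b n p).coeff (μ * τ⁻¹)) = (transition b n p).transpose := by
    ext μ τ
    rw [Matrix.transpose_apply, transition_apply, Matrix.of_apply, S, coeff_sum_single]
  refine LinearMap.ext fun v => ?_
  rw [h, Matrix.mulVecLin_apply, Matrix.mulVec_transpose, Matrix.vecMulLinear_apply]

theorem pow_inv_injective {b : ℕ} (hb : 1 < b) (m : ℕ) :
    Function.Injective fun k : Fin m => ((b : ℂ) ^ (k : ℕ))⁻¹ := by
  intro j k h
  have h1 : b ^ (j : ℕ) = b ^ (k : ℕ) := by exact_mod_cast inv_injective h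
  exact Fin.ext (Nat.pow_right_injective hb h1)

theorem finrank_range_mulLeft_eq_stirlingFrobeniusCycle
    {x : MonoidAlgebra ℂ (ColoredPerm n p)} (hx : IsIdempotentElem x) {j : ℕ}
    (h : x.coeff 1 = (u n p 0 j : ℂ)) :
    Module.finrank ℂ (LinearMap.range (LinearMap.mulLeft ℂ x)) =
      stirlingFrobeniusCycle p n (n - j) := by
  have h1 := finrank_range_mulLeft hx
  have h2 := congrArg (fun q : ℚ => (q : ℂ)) (stirlingFrobeniusCycle_eq_u n p j)
  push_cast at h2
  rw [h, card_eq] at h1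
  push_cast at h1
  have h3 : (Module.finrank ℂ (LinearMap.range (LinearMap.mulLeft ℂ x)) : ℂ) =
      stirlingFrobeniusCycle p n (n - j) := by
    rw [h1, h2]
    ring
  exact_mod_cast h3

end Shuffle

theorem mainTheorem5 (b n p : ℕ) [NeZero b] [NeZero p] (hn : 1 ≤ n) (hb : 1 < b)
    (hbp : b ≡ 1 [MOD p]) :
    -- the expansions that characterise the elements `e_m` and `f_m`
    (Shuffle.S b n p =
        ∑ k ∈ Finset.range (Shuffle.ell n p + 1),
          ((b : ℂ) ^ k)⁻¹ • Shuffle.e n p (Shuffle.ell n p - k) ∧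
      Shuffle.T b n p =
        ∑ k ∈ Finset.range (Shuffle.ell n p + 1),
          ((b : ℂ) ^ k)⁻¹ • Shuffle.f n p (Shuffle.ell n p - k)) ∧
    -- the set of eigenvalues
    (∀ lam : ℂ, Module.End.HasEigenvalue (Matrix.mulVecLin (Shuffle.transition b n p)) lam ↔
      ∃ j ≤ Shuffle.ell n p, lam = ((b : ℂ) ^ j)⁻¹) ∧
    ∀ j ≤ Shuffle.ell n p,
      -- the left and the right eigenspaces
      Shuffle.leftEigenspace (Shuffle.transition b n p) ((b : ℂ) ^ j)⁻¹ =
        Shuffle.rangeL (Shuffle.e n p (Shuffle.ell n p - j)) ∧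
      Shuffle.rightEigenspace (Shuffle.transition b n p) ((b : ℂ) ^ j)⁻¹ =
        Shuffle.rangeL (Shuffle.f n p (Shuffle.ell n p - j)) ∧
      -- the geometric (left and right) and the algebraic multiplicity
      Module.finrank ℂ
          (Shuffle.leftEigenspace (Shuffle.transition b n p) ((b : ℂ) ^ j)⁻¹) =
        Shuffle.stirlingFrobeniusCycle p n (n - j) ∧
      Module.finrank ℂ
          (Shuffle.rightEigenspace (Shuffle.transition b n p) ((b : ℂ) ^ j)⁻¹) =
        Shuffle.stirlingFrobeniusCycle p n (n - j) ∧
      (Shuffle.transition b n p).charpoly.rootMultiplicity ((b : ℂ) ^ j)⁻¹ =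
        Shuffle.stirlingFrobeniusCycle p n (n - j) ∧
      (Shuffle.stirlingFrobeniusCycle p n (n - j) : ℚ) =
        Shuffle.u n p 0 j * (p : ℚ) ^ n * (n.factorial : ℚ) := by
  classical
  have hS := Shuffle.S_eq_sum (n := n) hn hbp
  have hT := Shuffle.T_eq_sum (n := n) hn hbp
  have hS' := hS
  have hT' := hT
  rw [Finset.sum_range] at hS' hT'
  have hE := Shuffle.completeOrthogonalIdempotents_e (n := n) (p := p) hn
  have hF := Shuffle.completeOrthogonalIdempotents_f (n := n) (p := p) hn
  have hc := Shuffle.pow_inv_injective hb (Shuffle.ell n p + 1)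
  have : FiniteDimensional ℂ (MonoidAlgebra ℂ (ColoredPerm n p)) :=
    (Shuffle.coords n p).symm.finiteDimensional
  have hleft : ∀ j ≤ Shuffle.ell n p,
      Shuffle.leftEigenspace (Shuffle.transition b n p) ((b : ℂ) ^ j)⁻¹ =
        Shuffle.rangeL (Shuffle.e n p (Shuffle.ell n p - j)) := fun j hj => by
    rw [Shuffle.leftEigenspace, Shuffle.vecMulLinear_transition, Module.End.eigenspace_conj, hS',
      Shuffle.rangeL]
    exact congrArg _ (hE.eigenspace_mulLeft hc ⟨j, Nat.lt_succ_of_le hj⟩)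
  have hright : ∀ j ≤ Shuffle.ell n p,
      Shuffle.rightEigenspace (Shuffle.transition b n p) ((b : ℂ) ^ j)⁻¹ =
        Shuffle.rangeL (Shuffle.f n p (Shuffle.ell n p - j)) := fun j hj => by
    rw [Shuffle.rightEigenspace, Shuffle.mulVecLin_transition, Module.End.eigenspace_conj, hT',
      Shuffle.rangeL]
    exact congrArg _ (hF.eigenspace_mulLeft hc ⟨j, Nat.lt_succ_of_le hj⟩)
  have hdimE : ∀ j ≤ Shuffle.ell n p, Module.finrank ℂ
      (LinearMap.range (LinearMap.mulLeft ℂ (Shuffle.e n p (Shuffle.ell n p - j)))) =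
        Shuffle.stirlingFrobeniusCycle p n (n - j) := fun j hj =>
    Shuffle.finrank_range_mulLeft_eq_stirlingFrobeniusCycle (hE.idem ⟨j, Nat.lt_succ_of_le hj⟩)
      (by rw [Shuffle.coeff_e hn hj, inv_one, ColoredPerm.descents_one])
  have hdimF : ∀ j ≤ Shuffle.ell n p, Module.finrank ℂ
      (LinearMap.range (LinearMap.mulLeft ℂ (Shuffle.f n p (Shuffle.ell n p - j)))) =
        Shuffle.stirlingFrobeniusCycle p n (n - j) := fun j hj =>
    Shuffle.finrank_range_mulLeft_eq_stirlingFrobeniusCycle (hF.idem ⟨j, Nat.lt_succ_of_le hj⟩)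
      (by rw [Shuffle.coeff_f hn hj, ColoredPerm.descents_one])
  have hmult : ∀ j ≤ Shuffle.ell n p, Module.finrank ℂ
      (Shuffle.rightEigenspace (Shuffle.transition b n p) ((b : ℂ) ^ j)⁻¹) =
        Shuffle.stirlingFrobeniusCycle p n (n - j) := fun j hj => by
    rw [hright j hj, Shuffle.rangeL]
    exact (LinearEquiv.finrank_map_eq _ _).trans (hdimF j hj)
  refine ⟨⟨hS, hT⟩, fun lam => ⟨fun h => ?_, ?_⟩, fun j hj => ⟨hleft j hj, hright j hj, ?_,
    hmult j hj, ?_, Shuffle.stirlingFrobeniusCycle_eq_u n p j⟩⟩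
  · rw [Shuffle.mulVecLin_transition, hT', Module.End.hasEigenvalue_iff,
      Module.End.eigenspace_conj, Ne, Submodule.map_eq_bot_iff] at h
    obtain ⟨j, hj⟩ := hF.exists_eq_of_hasEigenvalue (Module.End.hasEigenvalue_iff.2 h)
    exact ⟨j, Nat.lt_succ_iff.1 j.2, hj⟩
  · rintro ⟨j, hj, rfl⟩
    rw [Module.End.hasEigenvalue_iff]
    intro h
    have h1 := hmult j hj
    rw [Shuffle.rightEigenspace, h, finrank_bot] at h1
    refine (Shuffle.stirlingFrobeniusCycle_pos (p := p) (Nat.sub_le n j) ?_).ne h1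
    have := NeZero.pos p
    unfold Shuffle.ell at hj
    split_ifs at hj <;> omega
  · rw [hleft j hj, Shuffle.rangeL]
    exact (LinearEquiv.finrank_map_eq _ _).trans (hdimE j hj)
  · rw [← Matrix.charpoly_mulVecLin, Shuffle.mulVecLin_transition, LinearEquiv.charpoly_conj,
      ← LinearMap.finrank_maxGenEigenspace_eq, hT', ← hdimF j hj]
    exact congrArg (fun W : Submodule ℂ _ => Module.finrank ℂ W)
      (hF.maxGenEigenspace_mulLeft hc ⟨j, Nat.lt_succ_of_le hj⟩)
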